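/- For $\alpha\in(0,1/2)$ let $\Gamma_\alpha=\{\sum_{i\ge1}\epsilon_i\alpha^i:\epsilon_i\in\{0,1\}\}$. Let $S_\alpha$ be the set of all $t\in\Gamma_\alpha-\Gamma_\alpha$ such that there is exactly one sequence $(t_i)_{i\ge1}\in\{-1,0,1\}^{\mathbb N}$ with $t=\sum_{i\ge1}t_i\alpha^i$, and such that $\Gamma_\alpha\cap(\Gamma_\alpha+t)$ is a self-similar set, i.e. a nonempty compact set $K\subset\mathbb R$ with $K=\bigcup_{j=1}^n f_j(K)$ for finitely many contracting similarities $f_1,\dots,f_n$ of $\mathbb R$. Let $$E_\alpha=\{\dim_H(\Gamma_\alpha\cap(\Gamma_\alpha+t)):t\in S_\alpha\}.$$ For every $\alpha\in(1/3,1/2)$ the set $E_\alpha$ is contained in $\left[0,\frac{\log 2}{-\log\alpha}\right]$. Moreover: 1. If $\alpha\in\left(\frac13,\frac{3-\sqrt5}{2}\right]$, then $E_\alpha$ is dense in $\left[0,\frac{\log 2}{-\log\alpha}\right]$. 2. If $\alpha\in\left(\frac{3-\sqrt5}{2},\frac12\right)$, then $E_\alpha$ is not dense in $\left[0,\frac{\log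 2}{-\log\alpha}\right]$. -/

import Mathlib

open scoped Pointwise

/-- The sequence `e` is an expansion of `x` in powers of `α` with digits in `A`, that is
`x = ∑_{i ≥ 1} e_i α ^ i` with every `e_i ∈ A`. The digit `e_i` of the mathematical text is
`e (i - 1)` here, since sequences are indexed from `0`. -/
def IsExpansion (A : Set ℤ) (α : ℝ) (e : ℕ → ℤ) (x : ℝ) : Prop :=
  (∀ i, e i ∈ A) ∧ HasSum (fun i : ℕ => (e i : ℝ) * α ^ (i + 1)) x

/-- The Cantor set `Γ_α` of all sums `∑_{i ≥ 1} e_i α ^ i` with digits `e_i ∈ {0, 1}`. -/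
def cantorGamma (α : ℝ) : Set ℝ :=
  {x | ∃ e : ℕ → ℤ, IsExpansion {0, 1} α e x}

/-- The intersection `Γ_α ∩ (Γ_α + t)`. -/
def cantorInter (α t : ℝ) : Set ℝ :=
  cantorGamma α ∩ (fun x => x + t) '' cantorGamma α

/-- The set of `t ∈ Γ_α - Γ_α` with exactly one expansion with digits in `{-1, 0, 1}`. -/
def univoqueSet (α : ℝ) : Set ℝ :=
  {t | t ∈ cantorGamma α - cantorGamma α ∧ ∃! e : ℕ → ℤ, IsExpansion {-1, 0, 1} α e t}

/-- `f` is a contracting similarity: it multiplies all distances by one ratio `r ∈ (0, 1)`. -/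
def IsContractingSimilarity (f : ℝ → ℝ) : Prop :=
  ∃ r : ℝ, 0 < r ∧ r < 1 ∧ ∀ x y, dist (f x) (f y) = r * dist x y

/-- `K` is a self-similar set: the nonempty compact attractor of a finite family of contracting
similarities (the family cannot be empty, because `K` is not). -/
def IsSelfSimilarSet (K : Set ℝ) : Prop :=
  K.Nonempty ∧ IsCompact K ∧ ∃ (n : ℕ) (f : Fin n → ℝ → ℝ),
    (∀ j, IsContractingSimilarity (f j)) ∧ K = ⋃ j, f j '' K

/-- The set `S_α` of those `t` with a unique expansion for which `Γ_α ∩ (Γ_α + t)` is a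
self-similar set. -/
def selfSimilarTranslations (α : ℝ) : Set ℝ :=
  {t | t ∈ univoqueSet α ∧ IsSelfSimilarSet (cantorInter α t)}

/-- The set of Hausdorff dimensions of `Γ_α ∩ (Γ_α + t)` for `t ∈ S_α`, as real numbers
(a subset of the line has dimension at most `1`, so `toReal` loses nothing). -/
noncomputable def selfSimilarDims (α : ℝ) : Set ℝ :=
  {d | ∃ t ∈ selfSimilarTranslations α, d = (dimH (cantorInter α t)).toReal}

/-! Write M = α / (1 - α) and L = log 2 / (-log α). If t has a unique expansion, any x = ∑ a_i α^i
in the intersection with x - t = ∑ b_i α^i satisfies a_i - b_i = t_i. So its digits are forced where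
t_i = ±1 and free where t_i = 0, and the intersection is a translate of the subset sums over the
zeros of (t_i) (`cantorInter_eq`). The density of these zeros controls the dimension as a fraction
of L (`dimH_subsetSums_le`, `le_dimH_subsetSums`).

Uniqueness is governed by tails: tails below 1 - M in absolute value force it (`eq_of_powSum_eq`),
while for α ≥ 1/3 a tail of at least 1 - M after a digit below 1 lets that digit be raised
(`tail_lt_of_unique`). The threshold (3 - √5)/2 is where α = 1 - M.

Below it, the differences of a periodic 0-1 sequence have tails less than α in absolute value, hence
are unique expansions, and every rational density in [0, 1] occurs. Above it, a digit 1 after a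
smaller one needs a tail bounded away from 0 on the negative side, so another nonzero digit
differing from its predecessor follows within N places, N depending on α only
(`exists_window_length`). Hence the zeros have full density or density at most 1 - 1/N for a fixed
window length N, which leaves a gap below L. -/

/-- The sum `∑_{i ≥ 0} d_i α ^ (i + 1)` of a power series with bounded coefficients. -/
noncomputable def powSum (α : ℝ) (d : ℕ → ℝ) : ℝ := ∑' i, d i * α ^ (i + 1)

/-! ### Power series with bounded coefficients -/

section PowSum

variable {α : ℝ}

theorem hasSum_pow_succ (h0 : 0 < α) (h1 : α < 1) :
    HasSum (fun i : ℕ => α ^ (i + 1)) (α / (1 - α)) := by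
  simpa [pow_succ', div_eq_mul_inv] using (hasSum_geometric_of_lt_one h0.le h1).mul_left α

theorem norm_mul_pow_succ_le (h0 : 0 < α) {d : ℕ → ℝ} (hd : ∀ i, |d i| ≤ 1) (i : ℕ) :
    ‖d i * α ^ (i + 1)‖ ≤ α ^ (i + 1) := by
  have hp : 0 < α ^ (i + 1) := by positivity
  rw [Real.norm_eq_abs, abs_mul, abs_of_pos hp]
  nlinarith [hd i]

theorem summable_mul_pow_succ (h0 : 0 < α) (h1 : α < 1) {d : ℕ → ℝ} (hd : ∀ i, |d i| ≤ 1) :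
    Summable fun i => d i * α ^ (i + 1) :=
  Summable.of_norm_bounded (hasSum_pow_succ h0 h1).summable (norm_mul_pow_succ_le h0 hd)

theorem hasSum_powSum (h0 : 0 < α) (h1 : α < 1) {d : ℕ → ℝ} (hd : ∀ i, |d i| ≤ 1) :
    HasSum (fun i => d i * α ^ (i + 1)) (powSum α d) :=
  (summable_mul_pow_succ h0 h1 hd).hasSum

theorem abs_powSum_le (h0 : 0 < α) (h1 : α < 1) {d : ℕ → ℝ} (hd : ∀ i, |d i| ≤ 1) :
    |powSum α d| ≤ α / (1 - α) :=
  tsum_of_norm_bounded (hasSum_pow_succ h0 h1) (norm_mul_pow_succ_le h0 hd)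

theorem powSum_nonneg (h0 : 0 < α) {d : ℕ → ℝ} (hd : ∀ i, 0 ≤ d i) : 0 ≤ powSum α d :=
  tsum_nonneg fun i => mul_nonneg (hd i) (by positivity)

theorem powSum_sub (h0 : 0 < α) (h1 : α < 1) {d e : ℕ → ℝ} (hd : ∀ i, |d i| ≤ 1)
    (he : ∀ i, |e i| ≤ 1) : powSum α (fun i => d i - e i) = powSum α d - powSum α e := by
  simp only [powSum, sub_mul]
  exact (summable_mul_pow_succ h0 h1 hd).tsum_sub (summable_mul_pow_succ h0 h1 he)

theorem powSum_neg (d : ℕ → ℝ) : powSum α (fun i => -d i) = -powSum α d := by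
  simp only [powSum, neg_mul, tsum_neg]

theorem powSum_split (h0 : 0 < α) (h1 : α < 1) {d : ℕ → ℝ} (hd : ∀ i, |d i| ≤ 1) (n : ℕ) :
    powSum α d = ∑ i ∈ Finset.range n, d i * α ^ (i + 1) +
      α ^ n * powSum α (fun i => d (n + i)) := by
  rw [powSum, ← (summable_mul_pow_succ h0 h1 hd).sum_add_tsum_nat_add n, powSum, ← tsum_mul_left]
  congr 2
  funext i
  rw [add_comm i n]
  ring

theorem powSum_succ (h0 : 0 < α) (h1 : α < 1) {d : ℕ → ℝ} (hd : ∀ i, |d i| ≤ 1) (n : ℕ) :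
    powSum α (fun i => d (n + i)) = α * (d n + powSum α (fun i => d (n + 1 + i))) := by
  rw [powSum_split h0 h1 (fun i => hd (n + i)) 1]
  simp [add_assoc]
  ring

theorem powSum_split_succ (h0 : 0 < α) (h1 : α < 1) {d : ℕ → ℝ} (hd : ∀ i, |d i| ≤ 1) (n : ℕ) :
    powSum α d = ∑ i ∈ Finset.range n, d i * α ^ (i + 1) +
      α ^ (n + 1) * (d n + powSum α (fun i => d (n + 1 + i))) := by
  rw [powSum_split h0 h1 hd n, powSum_succ h0 h1 hd n]
  ring

theorem div_one_sub_lt_one (h2 : α < 1 / 2) : α / (1 - α) < 1 := by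
  rw [div_lt_one (by linarith)]
  linarith

/-- A series whose first nonzero coefficient is large dominates its tail when `α < 1 / 2`. -/
theorem le_abs_powSum (h0 : 0 < α) (h2 : α < 1 / 2) {d : ℕ → ℝ} (hd : ∀ i, |d i| ≤ 1) {n : ℕ}
    (hz : ∀ i < n, d i = 0) (hn : |d n| = 1) :
    α ^ (n + 1) * (1 - α / (1 - α)) ≤ |powSum α d| := by
  have h1 : α < 1 := by linarith
  rw [powSum_split_succ h0 h1 hd n, Finset.sum_eq_zero, zero_add, abs_mul,
    abs_of_pos (by positivity : 0 < α ^ (n + 1))]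
  · gcongr
    have hb := abs_powSum_le h0 h1 (fun i => hd (n + 1 + i))
    have ht := abs_sub_abs_le_abs_sub (d n) (-powSum α fun i => d (n + 1 + i))
    rw [abs_neg, sub_neg_eq_add, hn] at ht
    linarith
  · intro i hi
    simp [hz i (Finset.mem_range.1 hi)]

end PowSum

/-! ### Existence and uniqueness of signed expansions -/

section Expansion

variable {α : ℝ}

theorem abs_intCast_le_one {a : ℤ} (h : a ∈ ({-1, 0, 1} : Set ℤ)) : |(a : ℝ)| ≤ 1 := by
  rcases h with rfl | rfl | rfl <;> simp

theorem mem_signs_of_mem_bits {a : ℤ} (h : a ∈ ({0, 1} : Set ℤ)) : a ∈ ({-1, 0, 1} : Set ℤ) :=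
  Or.inr h

theorem isExpansion_powSum (h0 : 0 < α) (h1 : α < 1) {A : Set ℤ} (hA : A ⊆ {-1, 0, 1})
    {e : ℕ → ℤ} (he : ∀ i, e i ∈ A) : IsExpansion A α e (powSum α fun i => (e i : ℝ)) :=
  ⟨he, hasSum_powSum h0 h1 fun i => abs_intCast_le_one (hA (he i))⟩

theorem IsExpansion.eq_powSum {A : Set ℤ} {e : ℕ → ℤ} {x : ℝ} (h : IsExpansion A α e x) :
    x = powSum α fun i => (e i : ℝ) :=
  h.2.tsum_eq.symm

/-- For `α ≥ 1 / 3` every point of `[-α / (1 - α), α / (1 - α)]` has an expansion with digits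
in `{-1, 0, 1}`. -/
theorem exists_isExpansion (h0 : 1 / 3 ≤ α) (h1 : α < 1) {x : ℝ} (hx : |x| ≤ α / (1 - α)) :
    ∃ e : ℕ → ℤ, IsExpansion {-1, 0, 1} α e x := by
  have hpos : 0 < α := by linarith
  have hs : 0 < 1 - α := by linarith
  have hM : α / (1 - α) = α * (1 + α / (1 - α)) := by field_simp; ring
  have hM2 : 1 / 2 ≤ α / (1 - α) := by
    rw [le_div_iff₀ hs]; linarith
  set M := α / (1 - α) with hMdef
  -- Since M ≥ 1/2, the intervals [a - M, a + M] with a = -1, 0, 1 cover [-1 - M, 1 + M], which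
  -- contains y / α because M = α(1 + M). Rounding with cuts at ±1/2 keeps the remainder in [-M, M].
  have step : ∀ y : ℝ, ∃ a : ℤ, |y| ≤ M → a ∈ ({-1, 0, 1} : Set ℤ) ∧ |y / α - a| ≤ M := by
    intro y
    have key : |y| ≤ M → |y / α| ≤ 1 + M := by
      intro h
      rw [abs_div, abs_of_pos hpos, div_le_iff₀ hpos]
      linarith
    rcases le_or_gt (y / α) (-(1 / 2)) with h | h
    · refine ⟨-1, fun hy => ⟨by simp, ?_⟩⟩
      have := abs_le.1 (key hy)
      rw [abs_le]; push_cast; constructor <;> linarith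
    rcases le_or_gt (y / α) (1 / 2) with h' | h'
    · refine ⟨0, fun hy => ⟨by simp, ?_⟩⟩
      rw [abs_le]; push_cast; constructor <;> linarith
    · refine ⟨1, fun hy => ⟨by simp, ?_⟩⟩
      have := abs_le.1 (key hy)
      rw [abs_le]; push_cast; constructor <;> linarith
  choose a ha using step
  let r : ℕ → ℝ := fun n => Nat.rec x (fun _ y => y / α - a y) n
  have hr : ∀ n, r (n + 1) = r n / α - a (r n) := fun n => rfl
  have hb : ∀ n, |r n| ≤ M := by
    intro n
    induction n with
    | zero => exact hx
    | succ n ih => rw [hr]; exact (ha _ ih).2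
  have hdig : ∀ n, a (r n) ∈ ({-1, 0, 1} : Set ℤ) := fun n => (ha _ (hb n)).1
  have hsum : ∀ n, ∑ i ∈ Finset.range n, (a (r i) : ℝ) * α ^ (i + 1) = x - α ^ n * r n := by
    intro n
    induction n with
    | zero => simp [r]
    | succ n ih =>
      rw [Finset.sum_range_succ, ih, hr]
      field_simp
      ring
  refine ⟨fun n => a (r n), hdig, ?_⟩
  rw [(summable_mul_pow_succ hpos h1
    fun i => abs_intCast_le_one (hdig i)).hasSum_iff_tendsto_nat]
  simp only [hsum]
  have : Filter.Tendsto (fun n => α ^ n * r n) Filter.atTop (nhds 0) := by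
    refine squeeze_zero_norm (a := fun n => α ^ n * M) (fun n => ?_) ?_
    · rw [norm_mul, norm_pow, Real.norm_eq_abs, Real.norm_eq_abs, abs_of_pos hpos]
      gcongr
      exact hb n
    · simpa using (tendsto_pow_atTop_nhds_zero_of_lt_one hpos.le h1).mul_const M
  simpa using tendsto_const_nhds.sub this

/-- A sequence of digits with small tails is the only expansion of its sum. -/
theorem eq_of_powSum_eq (h0 : 0 < α) (h1 : α < 1) {t e : ℕ → ℤ}
    (ht : ∀ i, t i ∈ ({-1, 0, 1} : Set ℤ)) (he : ∀ i, e i ∈ ({-1, 0, 1} : Set ℤ))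
    (htail : ∀ i, |powSum α fun j => (t (i + 1 + j) : ℝ)| < 1 - α / (1 - α))
    (h : powSum α (fun i => (e i : ℝ)) = powSum α fun i => (t i : ℝ)) : e = t := by
  by_contra hne
  obtain ⟨n, hn⟩ := Function.ne_iff.1 hne
  classical
  have hex : ∃ n, e n ≠ t n := ⟨n, hn⟩
  have hmin : ∀ i < Nat.find hex, e i = t i := fun i hi => not_not.1 (Nat.find_min hex hi)
  have hspec := Nat.find_spec hex
  set m := Nat.find hex
  have hE := fun i => abs_intCast_le_one (he i)
  have hT := fun i => abs_intCast_le_one (ht i)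
  rw [powSum_split_succ h0 h1 hE m, powSum_split_succ h0 h1 hT m,
    Finset.sum_congr rfl fun i hi => by rw [hmin i (Finset.mem_range.1 hi)]] at h
  have h3 := mul_left_cancel₀ (by positivity : α ^ (m + 1) ≠ 0) (add_left_cancel h)
  have hb := abs_le.1 (abs_powSum_le h0 h1 fun i => hE (m + 1 + i))
  have hc := abs_lt.1 (htail m)
  -- The digits at `m` differ by at least 1, but the tails differ by less than M + (1 - M) = 1.
  rcases lt_or_gt_of_ne hspec with hlt | hlt
  · have : (e m : ℝ) + 1 ≤ t m := by exact_mod_cast hlt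
    linarith
  · have : (t m : ℝ) + 1 ≤ e m := by exact_mod_cast hlt
    linarith

/-- In a unique expansion with digits in `{-1, 0, 1}` the tail after a digit below `1` is small,
since otherwise this digit could be increased. -/
theorem tail_lt_of_unique (h0 : 1 / 3 ≤ α) (h1 : α < 1) {t : ℕ → ℤ}
    (ht : ∀ i, t i ∈ ({-1, 0, 1} : Set ℤ))
    (huniq : ∀ e : ℕ → ℤ, (∀ i, e i ∈ ({-1, 0, 1} : Set ℤ)) →
      powSum α (fun i => (e i : ℝ)) = powSum α (fun i => (t i : ℝ)) → e = t)
    {n : ℕ} (hn : t n ≠ 1) : powSum α (fun j => (t (n + 1 + j) : ℝ)) < 1 - α / (1 - α) := by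
  by_contra! hcon
  have hpos : 0 < α := by linarith
  have hT := fun i => abs_intCast_le_one (ht i)
  have hb := abs_le.1 (abs_powSum_le hpos h1 fun i => hT (n + 1 + i))
  -- Raising digit `n` by one is paid for by lowering the tail by 1; the new tail stays in [-M, M]
  -- and so can be expanded again.
  obtain ⟨f, hf⟩ := exists_isExpansion h0 h1
    (x := powSum α (fun j => (t (n + 1 + j) : ℝ)) - 1)
    (abs_le.2 ⟨by linarith, by linarith⟩)
  let e : ℕ → ℤ := fun i => if i < n then t i else if i = n then t n + 1 else f (i - (n + 1))
  have he : ∀ i, e i ∈ ({-1, 0, 1} : Set ℤ) := by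
    intro i
    simp only [e]
    split_ifs
    · exact ht i
    · rcases ht n with h | h | h
      · simp [h]
      · simp [h]
      · exact absurd h hn
    · exact hf.1 _
  have hen : e n = t n + 1 := by simp [e]
  have heq : powSum α (fun i => (e i : ℝ)) = powSum α (fun i => (t i : ℝ)) := by
    rw [powSum_split_succ hpos h1 (fun i => abs_intCast_le_one (he i)) n,
      powSum_split_succ hpos h1 hT n]
    have e1 : ∀ i ∈ Finset.range n, (e i : ℝ) * α ^ (i + 1) = (t i : ℝ) * α ^ (i + 1) := by
      intro i hi
      simp [e, Finset.mem_range.1 hi]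
    have e2 : (fun i => (e (n + 1 + i) : ℝ)) = fun i => (f i : ℝ) := by
      funext i
      have h3 : ¬ n + 1 + i < n := by omega
      have h4 : ¬ n + 1 + i = n := by omega
      simp [e, h3, h4]
    rw [Finset.sum_congr rfl e1, e2, ← hf.eq_powSum, hen]
    push_cast
    ring
  have := congrFun (huniq e he heq) n
  omega

end Expansion

/-! ### Self-similarity and dimension of sets of subset sums -/

/-- The digit sequence that is `b` on `Z` and `0` elsewhere. -/
noncomputable def freeDigits (Z : Set ℕ) (b : ℕ → Bool) : ℕ → ℝ :=
  Z.indicator fun i => if b i = true then 1 else 0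

/-- The set of all sums `∑_{i ∈ S} α ^ (i + 1)` with `S ⊆ Z`. -/
noncomputable def subsetSums (α : ℝ) (Z : Set ℕ) : Set ℝ :=
  Set.range fun b : ℕ → Bool => powSum α (freeDigits Z b)

section SubsetSums

variable {α : ℝ} {Z : Set ℕ}

theorem freeDigits_eq_zero_or_one (Z : Set ℕ) (b : ℕ → Bool) (i : ℕ) :
    freeDigits Z b i = 0 ∨ freeDigits Z b i = 1 := by
  by_cases hi : i ∈ Z <;> by_cases hb : b i = true <;> simp [freeDigits, hi, hb]

theorem freeDigits_nonneg (Z : Set ℕ) (b : ℕ → Bool) (i : ℕ) : 0 ≤ freeDigits Z b i := by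
  rcases freeDigits_eq_zero_or_one Z b i with h | h <;> simp [h]

theorem abs_freeDigits_le (Z : Set ℕ) (b : ℕ → Bool) (i : ℕ) : |freeDigits Z b i| ≤ 1 := by
  rcases freeDigits_eq_zero_or_one Z b i with h | h <;> simp [h]

theorem isCompact_subsetSums (h0 : 0 < α) (h1 : α < 1) (Z : Set ℕ) :
    IsCompact (subsetSums α Z) := by
  refine isCompact_range ?_
  refine continuous_tsum (fun i => ?_) (hasSum_pow_succ h0 h1).summable
    fun i b => norm_mul_pow_succ_le h0 (abs_freeDigits_le Z b) i
  refine Continuous.mul ?_ continuous_const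
  by_cases hi : i ∈ Z
  · simp only [freeDigits, Set.indicator_of_mem hi]
    exact (continuous_of_discreteTopology (f := fun c : Bool => if c = true then (1 : ℝ) else 0)).comp
      (continuous_apply i)
  · simpa only [freeDigits, Set.indicator_of_notMem hi] using continuous_const

/-- The subset sums over a periodic set of exponents satisfy a finite self-similarity equation. -/
theorem isSelfSimilarSet_add_subsetSums (h0 : 0 < α) (h1 : α < 1) {p : ℕ} (hp : 0 < p)
    (hZ : ∀ i, p + i ∈ Z ↔ i ∈ Z) (c : ℝ) :
    IsSelfSimilarSet ((fun x => c + x) '' subsetSums α Z) := by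
  classical
  refine ⟨(Set.range_nonempty _).image _,
    (isCompact_subsetSums h0 h1 Z).image (continuous_const.add continuous_id), ?_⟩
  -- There is one similarity for each word of `p` digits: it prepends the word and shifts the old
  -- digits by a period.
  let pre : (Fin p → Bool) → ℝ := fun w =>
    ∑ i : Fin p, freeDigits Z (fun j => if h : j < p then w ⟨j, h⟩ else false) i * α ^ (i.1 + 1)
  let en := Fintype.equivFin (Fin p → Bool)
  have hpre : ∀ b : ℕ → Bool, pre (fun i => b i) =
      ∑ i ∈ Finset.range p, freeDigits Z b i * α ^ (i + 1) := by
    intro b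
    rw [← Fin.sum_univ_eq_sum_range (fun i => freeDigits Z b i * α ^ (i + 1))]
    refine Finset.sum_congr rfl fun i _ => ?_
    simp [freeDigits, Set.indicator]
  have hshift : ∀ b : ℕ → Bool, (fun i => freeDigits Z b (p + i)) =
      freeDigits Z fun i => b (p + i) := by
    intro b
    funext i
    simp [freeDigits, Set.indicator, hZ]
  have hsplit : ∀ b : ℕ → Bool, powSum α (freeDigits Z b) =
      pre (fun i => b i) + α ^ p * powSum α (freeDigits Z fun i => b (p + i)) := by
    intro b
    rw [powSum_split h0 h1 (abs_freeDigits_le Z b) p, hpre, hshift]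
  refine ⟨_, fun j x => c + (pre (en.symm j) + α ^ p * (x - c)), fun j => ⟨α ^ p, by positivity,
    pow_lt_one₀ h0.le h1 hp.ne', fun x y => ?_⟩, ?_⟩
  · rw [Real.dist_eq, Real.dist_eq, ← abs_of_pos (by positivity : 0 < α ^ p), ← abs_mul,
      abs_of_pos (by positivity : 0 < α ^ p)]
    congr 1
    ring
  · ext x
    simp only [Set.mem_iUnion, Set.mem_image, subsetSums, Set.mem_range, exists_exists_eq_and]
    constructor
    · rintro ⟨b, rfl⟩
      refine ⟨en fun i => b i, fun i => b (p + i), ?_⟩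
      rw [hsplit b]
      simp
    · rintro ⟨j, b, rfl⟩
      refine ⟨fun i => if h : i < p then en.symm j ⟨i, h⟩ else b (i - p), ?_⟩
      rw [hsplit]
      simp

/-- The exponent is chosen so that a cylinder of scale α^n has weight 2^(-ρn), which balances about
2^(ρn) choices of digits. -/
theorem pow_rpow_mul_log_div (h0 : 0 < α) (h1 : α < 1) (ρ : ℝ) (n : ℕ) :
    (α ^ n) ^ (ρ * (Real.log 2 / -Real.log α)) = (2 : ℝ) ^ (-(ρ * n)) := by
  have hlog : Real.log α ≠ 0 := (Real.log_neg h0 h1).ne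
  rw [← Real.rpow_natCast, ← Real.rpow_mul h0.le, Real.rpow_def_of_pos h0,
    Real.rpow_def_of_pos two_pos]
  congr 1
  field_simp

open Classical in
/-- Upper bound for the dimension of a set of subset sums by counting the admissible exponents
along a sequence of levels. -/
theorem dimH_subsetSums_le (h0 : 0 < α) (h1 : α < 1) {ρ C : ℝ} (hρ : 0 ≤ ρ) {φ : ℕ → ℕ}
    (hφ : Filter.Tendsto φ Filter.atTop Filter.atTop)
    (hcount : ∀ m, (Nat.count (· ∈ Z) (φ m) : ℝ) ≤ ρ * φ m + C) :
    dimH (subsetSums α Z) ≤ ENNReal.ofReal (ρ * (Real.log 2 / -Real.log α)) := by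
  have hlog : 0 < -Real.log α := neg_pos.2 (Real.log_neg h0 h1)
  have hM : 0 < α / (1 - α) := div_pos h0 (by linarith)
  set M := α / (1 - α) with hMdef
  set s := ρ * (Real.log 2 / -Real.log α) with hs
  have hs0 : 0 ≤ s := mul_nonneg hρ (div_nonneg (Real.log_nonneg one_le_two) hlog.le)
  have hpow : ∀ n : ℕ, (α ^ n) ^ s = (2 : ℝ) ^ (-(ρ * n)) :=
    pow_rpow_mul_log_div h0 h1 ρ
  refine dimH_le_of_hausdorffMeasure_ne_top (ne_top_of_le_ne_top
    (ENNReal.ofReal_ne_top (r := (2 : ℝ) ^ C * M ^ s)) ?_)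
  rw [Real.coe_toNNReal s hs0]
  let S : ℕ → Finset ℕ := fun m => (Finset.range (φ m)).filter (· ∈ Z)
  let r : ℕ → ℝ := fun m => α ^ φ m * M
  -- Fixing the free digits before `φ m` confines the sum to an interval whose length `r m` is the
  -- largest possible tail.
  let cyl : ∀ m, (S m).powerset → Set ℝ := fun m P =>
    Set.Icc (∑ i ∈ P.1, α ^ (i + 1)) (∑ i ∈ P.1, α ^ (i + 1) + r m)
  have hdiam : ∀ m P, Metric.ediam (cyl m P) = ENNReal.ofReal (r m) := by
    intro m P
    simp only [cyl]
    rw [Real.ediam_Icc, add_sub_cancel_left]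
  have htend : Filter.Tendsto (fun m => ENNReal.ofReal (r m)) Filter.atTop (nhds 0) := by
    have : Filter.Tendsto r Filter.atTop (nhds 0) := by
      simpa using ((tendsto_pow_atTop_nhds_zero_of_lt_one h0.le h1).comp hφ).mul_const M
    simpa using ENNReal.tendsto_ofReal this
  have hcover : ∀ m, subsetSums α Z ⊆ ⋃ P, cyl m P := by
    rintro m _ ⟨b, rfl⟩
    rw [Set.mem_iUnion]
    refine ⟨⟨(S m).filter (fun i => b i = true), by simp⟩, ?_⟩
    have hsum : ∑ i ∈ (S m).filter (fun i => b i = true), α ^ (i + 1) =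
        ∑ i ∈ Finset.range (φ m), freeDigits Z b i * α ^ (i + 1) := by
      simp only [S, Finset.filter_filter]
      rw [Finset.sum_filter]
      refine Finset.sum_congr rfl fun i _ => ?_
      by_cases hi : i ∈ Z <;> by_cases hb : b i = true <;> simp [freeDigits, hi, hb]
    simp only [cyl, hsum]
    rw [powSum_split h0 h1 (abs_freeDigits_le Z b) (φ m)]
    have hn := powSum_nonneg h0 (fun i => freeDigits_nonneg Z b (φ m + i))
    have hb := (abs_le.1 (abs_powSum_le h0 h1 fun i => abs_freeDigits_le Z b (φ m + i))).2
    have hp : 0 < α ^ φ m := by positivity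
    exact ⟨le_add_of_nonneg_right (by positivity), by simp only [r]; gcongr⟩
  refine (MeasureTheory.Measure.hausdorffMeasure_le_liminf_sum s _ _ htend cyl
    (Filter.Eventually.of_forall fun m P => (hdiam m P).le)
    (Filter.Eventually.of_forall hcover)).trans ?_
  refine Filter.liminf_le_of_frequently_le' (Filter.Frequently.of_forall fun m => ?_)
  have hcard : (Finset.univ : Finset (S m).powerset).card = 2 ^ Nat.count (· ∈ Z) (φ m) := by
    rw [Finset.card_univ, Fintype.card_coe, Finset.card_powerset, Nat.count_eq_card_filter_range]
  simp only [hdiam, Finset.sum_const, hcard, nsmul_eq_mul]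
  have hr0 : 0 ≤ r m := by positivity
  rw [ENNReal.ofReal_rpow_of_nonneg hr0 hs0, ← ENNReal.ofReal_natCast,
    ← ENNReal.ofReal_mul (by positivity)]
  refine ENNReal.ofReal_le_ofReal ?_
  simp only [r]
  rw [Real.mul_rpow (by positivity) hM.le, hpow, ← mul_assoc]
  gcongr
  push_cast
  rw [← Real.rpow_natCast, ← Real.rpow_add two_pos]
  refine Real.rpow_le_rpow_of_exponent_le one_le_two ?_
  linarith [hcount m]

open Classical in
/-- Reading binary digits off at the positions in `Z` only. The remainder after `n` positions. -/
noncomputable def binaryRemainder (Z : Set ℕ) (y : ℝ) : ℕ → ℝ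
  | 0 => y
  | n + 1 => if n ∈ Z then
      2 * binaryRemainder Z y n - (if 1 / 2 ≤ binaryRemainder Z y n then 1 else 0)
    else binaryRemainder Z y n

/-- The binary digit of `y` that is read at position `n`. -/
noncomputable def binaryDigit (Z : Set ℕ) (y : ℝ) (n : ℕ) : Bool :=
  open Classical in decide (1 / 2 ≤ binaryRemainder Z y n)

theorem binaryRemainder_mem (Z : Set ℕ) {y : ℝ} (hy : y ∈ Set.Icc (0 : ℝ) 1) (n : ℕ) :
    binaryRemainder Z y n ∈ Set.Icc (0 : ℝ) 1 := by
  induction n with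
  | zero => exact hy
  | succ n ih =>
    obtain ⟨h1, h2⟩ := ih
    simp only [binaryRemainder]
    split_ifs <;> constructor <;> linarith

open Classical in
/-- Numbers with the same digits up to position `n` differ by the scaled difference of their
remainders. -/
theorem sub_eq_of_binaryDigit_eq {y y' : ℝ} {n : ℕ}
    (h : ∀ i < n, i ∈ Z → binaryDigit Z y i = binaryDigit Z y' i) :
    2 ^ Nat.count (· ∈ Z) n * (y - y') = binaryRemainder Z y n - binaryRemainder Z y' n := by
  induction n with
  | zero => simp [binaryRemainder]
  | succ n ih =>
    have ih' := ih fun i hi => h i (by omega)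
    rw [Nat.count_succ]
    by_cases hn : n ∈ Z
    · have hd := h n (by omega) hn
      simp only [binaryDigit, decide_eq_decide] at hd
      simp only [binaryRemainder, hn, if_true, hd]
      rw [pow_succ]
      linarith
    · simp only [binaryRemainder, hn, if_false, add_zero]
      exact ih'

open Classical in
/-- Lower bound for the dimension of a set of subset sums by counting the admissible exponents:
the set maps onto the unit interval by a Hölder map. -/
theorem le_dimH_subsetSums (h0 : 0 < α) (h2 : α < 1 / 2) {ρ C : ℝ} (hρ : 0 < ρ)
    (hcount : ∀ n, ρ * n - C ≤ (Nat.count (· ∈ Z) n : ℝ)) :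
    ENNReal.ofReal (ρ * (Real.log 2 / -Real.log α)) ≤ dimH (subsetSums α Z) := by
  have h1 : α < 1 := by linarith
  have hlog : 0 < -Real.log α := neg_pos.2 (Real.log_neg h0 h1)
  have hτ : 0 < 1 - α / (1 - α) := by linarith [div_one_sub_lt_one h2]
  set τ := 1 - α / (1 - α) with hτdef
  set s := ρ * (Real.log 2 / -Real.log α) with hs
  have hs0 : 0 < s := mul_pos hρ (div_pos (Real.log_pos one_lt_two) hlog)
  have hpow : ∀ n : ℕ, (α ^ n) ^ s = (2 : ℝ) ^ (-(ρ * n)) :=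
    pow_rpow_mul_log_div h0 h1 ρ
  let g : ℝ → ℝ := fun y => powSum α (freeDigits Z (binaryDigit Z y))
  -- If the digits first disagree at `n`, then |y - y'| ≤ 2^C (α^n)^s and |g y - g y'| ≥ α^(n+1) τ.
  -- `D` is the ratio of the first bound to the `s`-th power of the second.
  set D : ℝ := 2 ^ C / (α * τ) ^ s with hD
  have hD0 : 0 ≤ D := by positivity
  -- the count bound turned into a bound for the binary scale
  have hscale : ∀ n, ((2 : ℝ) ^ Nat.count (· ∈ Z) n)⁻¹ ≤ 2 ^ C * (α ^ n) ^ s := by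
    intro n
    rw [hpow, ← Real.rpow_natCast, ← Real.rpow_neg two_pos.le, ← Real.rpow_add two_pos]
    exact Real.rpow_le_rpow_of_exponent_le one_le_two (by linarith [hcount n])
  have hclose : ∀ y ∈ Set.Icc (0 : ℝ) 1, ∀ y' ∈ Set.Icc (0 : ℝ) 1, ∀ n,
      (∀ i < n, i ∈ Z → binaryDigit Z y i = binaryDigit Z y' i) →
      |y - y'| ≤ 2 ^ C * (α ^ n) ^ s := by
    intro y hy y' hy' n hn
    refine le_trans ?_ (hscale n)
    have := sub_eq_of_binaryDigit_eq hn
    have hr := binaryRemainder_mem Z hy n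
    have hr' := binaryRemainder_mem Z hy' n
    rw [← one_div, le_div_iff₀ (by positivity), ← abs_of_pos
      (by positivity : (0 : ℝ) < 2 ^ Nat.count (· ∈ Z) n), ← abs_mul, mul_comm, this, abs_le]
    constructor <;> linarith [hr.1, hr.2, hr'.1, hr'.2]
  have hkey : ∀ y ∈ Set.Icc (0 : ℝ) 1, ∀ y' ∈ Set.Icc (0 : ℝ) 1,
      |y - y'| ≤ D * |g y - g y'| ^ s := by
    intro y hy y' hy'
    by_cases hex : ∃ n, n ∈ Z ∧ binaryDigit Z y n ≠ binaryDigit Z y' n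
    · have hspec := Nat.find_spec hex
      have hmin : ∀ i < Nat.find hex, i ∈ Z → binaryDigit Z y i = binaryDigit Z y' i :=
        fun i hi hiZ => not_not.1 fun hne => Nat.find_min hex hi ⟨hiZ, hne⟩
      set n := Nat.find hex
      refine (hclose y hy y' hy' n hmin).trans ?_
      have hsep : α ^ (n + 1) * τ ≤ |g y - g y'| := by
        simp only [g]
        rw [← powSum_sub h0 h1 (abs_freeDigits_le _ _) (abs_freeDigits_le _ _)]
        refine le_abs_powSum h0 h2 (fun i => ?_) (fun i hi => ?_) ?_
        · rcases freeDigits_eq_zero_or_one Z (binaryDigit Z y) i with h | h <;>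
            rcases freeDigits_eq_zero_or_one Z (binaryDigit Z y') i with h' | h' <;> simp [h, h']
        · by_cases hiZ : i ∈ Z
          · simp [freeDigits, hiZ, hmin i hi hiZ]
          · simp [freeDigits, hiZ]
        · obtain ⟨hnZ, hne⟩ := hspec
          cases hA : binaryDigit Z y n <;> cases hB : binaryDigit Z y' n <;>
            simp [freeDigits, hnZ, hA, hB] at hne ⊢
      calc 2 ^ C * (α ^ n) ^ s = D * (α ^ (n + 1) * τ) ^ s := by
            rw [show α ^ (n + 1) * τ = α ^ n * (α * τ) by ring,
              Real.mul_rpow (by positivity) (by positivity), hD]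
            have : (α * τ) ^ s ≠ 0 := by positivity
            field_simp
        _ ≤ D * |g y - g y'| ^ s := by gcongr
    · push Not at hex
      have hlim : Filter.Tendsto (fun n : ℕ => 2 ^ C * (α ^ n) ^ s) Filter.atTop (nhds 0) := by
        have := (tendsto_pow_atTop_nhds_zero_of_lt_one h0.le h1).rpow_const (p := s)
          (Or.inr hs0.le)
        simpa [Real.zero_rpow hs0.ne'] using this.const_mul ((2 : ℝ) ^ C)
      have := ge_of_tendsto' hlim fun n => hclose y hy y' hy' n fun i _ hiZ => hex i hiZ
      exact this.trans (by positivity)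
  have hinj : Set.InjOn g (Set.Icc 0 1) := by
    intro y hy y' hy' h
    have := hkey y hy y' hy'
    rw [h, sub_self, abs_zero, Real.zero_rpow hs0.ne', mul_zero] at this
    linarith [abs_nonpos_iff.1 this]
  -- The inverse of `g` is `s`-Hölder from the image onto [0, 1], so the image has dimension at
  -- least `s`.
  have hholder : HolderOnWith D.toNNReal s.toNNReal (Function.invFunOn g (Set.Icc 0 1))
      (g '' Set.Icc 0 1) := by
    rintro _ ⟨y, hy, rfl⟩ _ ⟨y', hy', rfl⟩
    rw [hinj.leftInvOn_invFunOn hy, hinj.leftInvOn_invFunOn hy', edist_dist, edist_dist,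
      Real.dist_eq, Real.dist_eq, Real.coe_toNNReal s hs0.le,
      ENNReal.ofReal_rpow_of_nonneg (abs_nonneg _) hs0.le, ENNReal.ofNNReal_toNNReal, ← ENNReal.ofReal_mul hD0]
    exact ENNReal.ofReal_le_ofReal (hkey y hy y' hy')
  have hdim := hholder.dimH_image_le (Real.toNNReal_pos.2 hs0)
  rw [hinj.invFunOn_image subset_rfl, Real.dimH_of_nonempty_interior (by simp),
    Module.finrank_self, Nat.cast_one, ENNReal.ofNNReal_toNNReal,
    ENNReal.le_div_iff_mul_le (by simp [hs0]) (by simp), one_mul] at hdim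
  refine hdim.trans (dimH_mono ?_)
  rintro _ ⟨y, -, rfl⟩
  exact ⟨_, rfl⟩

end SubsetSums

/-! ### The intersection as a set of subset sums -/

section Intersection

variable {α : ℝ}

theorem signs_cases {a : ℤ} (h : a ∈ ({-1, 0, 1} : Set ℤ)) : a = -1 ∨ a = 0 ∨ a = 1 := h

theorem bits_cases {a : ℤ} (h : a ∈ ({0, 1} : Set ℤ)) : a = 0 ∨ a = 1 := h

/-- For a translation with a unique expansion the intersection of the two Cantor sets is a
translate of the set of subset sums over the zero digits. -/
theorem cantorInter_eq (h0 : 0 < α) (h1 : α < 1) {t : ℝ} {e : ℕ → ℤ}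
    (he : IsExpansion {-1, 0, 1} α e t)
    (huniq : ∀ f : ℕ → ℤ, IsExpansion {-1, 0, 1} α f t → f = e) :
    cantorInter α t = (fun x => (powSum α fun i => ((max (e i) 0 : ℤ) : ℝ)) + x) ''
      subsetSums α {i | e i = 0} := by
  have hmax : ∀ i, |((max (e i) 0 : ℤ) : ℝ)| ≤ 1 := fun i => by
    rcases signs_cases (he.1 i) with h | h | h <;> simp [h]
  ext x
  constructor
  · rintro ⟨⟨a, ha⟩, y, ⟨b, hb⟩, hxy⟩
    have hab : (fun i => a i - b i) = e := by
      refine huniq _ ⟨fun i => ?_, ?_⟩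
      · rcases bits_cases (ha.1 i) with h | h <;> rcases bits_cases (hb.1 i) with h' | h' <;>
          simp only [h, h'] <;> simp
      · have := ha.2.sub hb.2
        rw [← hxy, add_sub_cancel_left] at this
        simpa [sub_mul] using this
    have haE : ∀ i, |(a i : ℝ)| ≤ 1 := fun i =>
      abs_intCast_le_one (mem_signs_of_mem_bits (ha.1 i))
    refine ⟨_, ⟨fun i => decide (a i = 1), rfl⟩, ?_⟩
    -- A digit 1 of `e` forces a = 1 and a digit -1 forces a = 0, so `max (e i) 0` is the forced
    -- part of `a`.
    have : freeDigits {i | e i = 0} (fun i => decide (a i = 1)) =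
        fun i => (a i : ℝ) - ((max (e i) 0 : ℤ) : ℝ) := by
      funext i
      have hi := congrFun hab i
      rcases bits_cases (ha.1 i) with h | h <;> rcases bits_cases (hb.1 i) with h' | h' <;> rw [h, h'] at hi <;>
        norm_num at hi <;> simp [freeDigits, h, ← hi]
    simp only [this]
    rw [powSum_sub h0 h1 haE hmax, ← ha.eq_powSum]
    ring
  · rintro ⟨_, ⟨b, rfl⟩, rfl⟩
    let a : ℕ → ℤ := fun i => if e i = 0 then (if b i = true then 1 else 0) else max (e i) 0
    have ha : ∀ i, a i ∈ ({0, 1} : Set ℤ) := fun i => by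
      rcases signs_cases (he.1 i) with h | h | h <;> cases hb : b i <;> simp [a, h, hb]
    have hae : ∀ i, a i - e i ∈ ({0, 1} : Set ℤ) := fun i => by
      rcases signs_cases (he.1 i) with h | h | h <;> cases hb : b i <;> simp [a, h, hb]
    have haE : ∀ i, |(a i : ℝ)| ≤ 1 := fun i => abs_intCast_le_one (mem_signs_of_mem_bits (ha i))
    have hsum : powSum α (fun i => ((max (e i) 0 : ℤ) : ℝ)) +
        powSum α (freeDigits {i | e i = 0} b) = powSum α fun i => (a i : ℝ) := by
      have : freeDigits {i | e i = 0} b = fun i => (a i : ℝ) - ((max (e i) 0 : ℤ) : ℝ) := by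
        funext i
        rcases signs_cases (he.1 i) with h | h | h <;> cases hb : b i <;> simp [a, freeDigits, h, hb]
      rw [this, powSum_sub h0 h1 haE hmax]
      ring
    simp only [hsum]
    refine ⟨⟨a, isExpansion_powSum h0 h1 (fun _ => mem_signs_of_mem_bits) ha⟩, _,
      ⟨_, isExpansion_powSum h0 h1 (fun _ => mem_signs_of_mem_bits) hae⟩, ?_⟩
    push_cast
    rw [powSum_sub h0 h1 haE fun i => abs_intCast_le_one (he.1 i), ← he.eq_powSum]
    ring

/-- Every sum with digits in `{-1, 0, 1}` is a difference of two points of the Cantor set. -/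
theorem IsExpansion.mem_sub (h0 : 0 < α) (h1 : α < 1) {t : ℝ} {e : ℕ → ℤ}
    (he : IsExpansion {-1, 0, 1} α e t) : t ∈ cantorGamma α - cantorGamma α := by
  have hp : ∀ i, max (e i) 0 ∈ ({0, 1} : Set ℤ) := fun i => by
    rcases signs_cases (he.1 i) with h | h | h <;> simp [h]
  have hn : ∀ i, max (-e i) 0 ∈ ({0, 1} : Set ℤ) := fun i => by
    rcases signs_cases (he.1 i) with h | h | h <;> simp [h]
  refine Set.mem_sub.2 ⟨_, ⟨_, isExpansion_powSum h0 h1 (fun _ => mem_signs_of_mem_bits) hp⟩, _,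
    ⟨_, isExpansion_powSum h0 h1 (fun _ => mem_signs_of_mem_bits) hn⟩, ?_⟩
  rw [← powSum_sub h0 h1 (fun i => abs_intCast_le_one (mem_signs_of_mem_bits (hp i)))
    (fun i => abs_intCast_le_one (mem_signs_of_mem_bits (hn i))), he.eq_powSum]
  congr 1
  funext i
  rcases signs_cases (he.1 i) with h | h | h <;> simp [h]

theorem dimH_add_image (c : ℝ) (s : Set ℝ) : dimH ((fun x => c + x) '' s) = dimH s :=
  (isometry_add_left c).dimH_image s

theorem logTwo_div_neg_log_pos (h0 : 0 < α) (h1 : α < 1) : 0 < Real.log 2 / -Real.log α :=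
  div_pos (Real.log_pos one_lt_two) (neg_pos.2 (Real.log_neg h0 h1))

theorem toReal_dimH_subsetSums_le (h0 : 0 < α) (h1 : α < 1) (Z : Set ℕ) :
    (dimH (subsetSums α Z)).toReal ≤ Real.log 2 / -Real.log α := by
  classical
  have h := dimH_subsetSums_le (Z := Z) h0 h1 zero_le_one Filter.tendsto_id (C := 0) fun m => by
    simpa using Nat.count_le _
  rw [one_mul] at h
  exact ENNReal.toReal_le_of_le_ofReal (logTwo_div_neg_log_pos h0 h1).le h

theorem selfSimilarDims_subset (h0 : 0 < α) (h1 : α < 1) :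
    selfSimilarDims α ⊆ Set.Icc 0 (Real.log 2 / -Real.log α) := by
  rintro d ⟨t, ⟨⟨-, e, he, huniq⟩, -⟩, rfl⟩
  rw [cantorInter_eq h0 h1 he huniq, dimH_add_image]
  exact ⟨ENNReal.toReal_nonneg, toReal_dimH_subsetSums_le h0 h1 _⟩

end Intersection

/-! ### Density below the threshold -/

section Dense

variable {α : ℝ}

theorem powSum_pos (h0 : 0 < α) (h1 : α < 1) {d : ℕ → ℝ} (hd : ∀ i, d i ∈ Set.Icc (0 : ℝ) 1)
    {j : ℕ} (hj : 0 < d j) : 0 < powSum α d :=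
  (summable_mul_pow_succ h0 h1 fun i => abs_le.2 ⟨by linarith [(hd i).1], (hd i).2⟩).tsum_pos
    (fun i => mul_nonneg (hd i).1 (by positivity)) j (by positivity)

theorem powSum_one (h0 : 0 < α) (h1 : α < 1) : powSum α (fun _ => 1) = α / (1 - α) := by
  simpa [powSum] using (hasSum_pow_succ h0 h1).tsum_eq

/-- The differences of a periodic sequence of zeros and ones form a digit sequence whose tails
are smaller than `α`. -/
theorem abs_powSum_diff_lt (h0 : 0 < α) (h1 : α < 1) {E : ℕ → ℤ}
    (hE : ∀ i, E i ∈ ({0, 1} : Set ℤ)) {p : ℕ} (hp : 0 < p) (hper : ∀ i, E (p + i) = E i) (n : ℕ) :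
    |powSum α fun j => ((E (n + j + 1) - E (n + j) : ℤ) : ℝ)| < α := by
  have hIcc : ∀ i, (E i : ℝ) ∈ Set.Icc (0 : ℝ) 1 := fun i => by
    rcases bits_cases (hE i) with h | h <;> simp [h]
  have habs : ∀ i, |(E i : ℝ)| ≤ 1 := fun i =>
    abs_intCast_le_one (mem_signs_of_mem_bits (hE i))
  have hM : (1 - α) * (α / (1 - α)) = α := mul_div_cancel₀ _ (by linarith)
  -- Summation by parts: with T the tail of `E` after `n`, the value is (1 - α)T - α E_n. As 0 ≤ T ≤
  -- M and (1 - α)M = α, it lies in [-α, α].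
  have htail : powSum α (fun j => ((E (n + j + 1) - E (n + j) : ℤ) : ℝ)) =
      (1 - α) * powSum α (fun j => (E (n + 1 + j) : ℝ)) - α * E n := by
    have e1 : (fun j => ((E (n + j + 1) - E (n + j) : ℤ) : ℝ)) =
        fun j => (E (n + 1 + j) : ℝ) - E (n + j) := by
      funext j
      rw [show n + j + 1 = n + 1 + j by ring]
      push_cast
      ring
    rw [e1, powSum_sub h0 h1 (fun j => habs (n + 1 + j)) (fun j => habs (n + j)),
      powSum_succ h0 h1 habs n]
    ring
  -- The digit `E n` recurs one period later, so T < M if it is 0 and T > 0 if it is 1. This makes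
  -- the bound strict.
  have hagain : E (n + 1 + (p - 1)) = E n := by
    rw [show n + 1 + (p - 1) = p + n by omega, hper]
  have hle := (abs_le.1 (abs_powSum_le h0 h1 fun j => habs (n + 1 + j))).2
  have hge := powSum_nonneg h0 fun j => (hIcc (n + 1 + j)).1
  rw [htail, abs_lt]
  have hs : 0 < 1 - α := by linarith
  have hle' := mul_le_mul_of_nonneg_left hle hs.le
  have hge' := mul_nonneg hs.le hge
  rcases bits_cases (hE n) with h | h
  · have hlt : 0 < powSum α fun j => 1 - (E (n + 1 + j) : ℝ) :=
      powSum_pos h0 h1 (fun j => ⟨by linarith [(hIcc (n + 1 + j)).2],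
        by linarith [(hIcc (n + 1 + j)).1]⟩) (j := p - 1) (by rw [hagain, h]; simp)
    rw [powSum_sub h0 h1 (fun _ => by simp) (fun j => habs (n + 1 + j)), powSum_one h0 h1] at hlt
    have := mul_pos hs hlt
    rw [h]
    push_cast
    constructor <;> nlinarith
  · have hlt : 0 < powSum α fun j => (E (n + 1 + j) : ℝ) :=
      powSum_pos h0 h1 (fun j => hIcc (n + 1 + j)) (j := p - 1) (by rw [hagain, h]; simp)
    have := mul_pos hs hlt
    rw [h]
    push_cast
    constructor <;> linarith

/-- If `α ≤ 1 - α / (1 - α)`, every periodic sequence of zeros and ones gives a self-similar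
intersection, whose dimension is that of the subset sums over the positions where the sequence
does not change. -/
theorem toReal_dimH_mem_selfSimilarDims (h0 : 0 < α) (h1 : α < 1)
    (hα : α ≤ 1 - α / (1 - α)) {E : ℕ → ℤ} (hE : ∀ i, E i ∈ ({0, 1} : Set ℤ)) {p : ℕ}
    (hp : 0 < p) (hper : ∀ i, E (p + i) = E i) :
    (dimH (subsetSums α {i | E (i + 1) = E i})).toReal ∈ selfSimilarDims α := by
  let t : ℕ → ℤ := fun i => E (i + 1) - E i
  have ht : ∀ i, t i ∈ ({-1, 0, 1} : Set ℤ) := fun i => by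
    rcases bits_cases (hE i) with h | h <;> rcases bits_cases (hE (i + 1)) with h' | h' <;> simp only [t, h, h'] <;> simp
  have hexp := isExpansion_powSum h0 h1 subset_rfl ht
  have huniq : ∀ f : ℕ → ℤ, IsExpansion {-1, 0, 1} α f (powSum α fun i => (t i : ℝ)) → f = t :=
    fun f hf => eq_of_powSum_eq h0 h1 ht hf.1
      (fun i => (abs_powSum_diff_lt h0 h1 hE hp hper (i + 1)).trans_le hα) hf.eq_powSum.symm
  have hinter := cantorInter_eq h0 h1 hexp huniq
  have hZ : {i | t i = 0} = {i | E (i + 1) = E i} := by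
    ext i
    simp [t, sub_eq_zero]
  rw [hZ] at hinter
  refine ⟨_, ⟨⟨hexp.mem_sub h0 h1, t, hexp, huniq⟩, ?_⟩, ?_⟩
  · rw [hinter]
    refine isSelfSimilarSet_add_subsetSums h0 h1 hp (fun i => ?_) _
    simp only [Set.mem_ofPred_eq, add_assoc, hper]
  · rw [hinter, dimH_add_image]

theorem count_le_mod (a k q : ℕ) :
    Nat.count (fun i => a ≤ i % k) (k * q) = q * (k - a) := by
  induction q with
  | zero => simp
  | succ q ih =>
    rw [mul_add_one, Nat.count_add, ih, add_mul, one_mul]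
    congr 1
    simp only [Nat.mul_add_mod]
    have : ∀ n ≤ k, Nat.count (fun i => a ≤ i % k) n = n - a := by
      intro n
      induction n with
      | zero => simp
      | succ n ihn =>
        intro hn
        rw [Nat.count_succ, ihn (by omega), Nat.mod_eq_of_lt (by omega : n < k)]
        split_ifs <;> omega
    exact this k le_rfl

open Classical in
/-- The dimension of the subset sums over a periodic union of blocks. -/
theorem toReal_dimH_subsetSums_mod (h0 : 0 < α) (h2 : α < 1 / 2) {a k : ℕ} (hk : 0 < k)
    (ha : a ≤ k) : (dimH (subsetSums α {i | a ≤ i % k})).toReal =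
      (1 - (a : ℝ) / k) * (Real.log 2 / -Real.log α) := by
  have h1 : α < 1 := by linarith
  have hkR : (0 : ℝ) < k := by exact_mod_cast hk
  have haR : (a : ℝ) ≤ k := by exact_mod_cast ha
  obtain ⟨Z, hZ⟩ : ∃ Z : Set ℕ, Z = {i | a ≤ i % k} := ⟨_, rfl⟩
  rw [← hZ]
  have hcount : ∀ q, (Nat.count (· ∈ Z) (k * q) : ℝ) =
      (1 - (a : ℝ) / k) * (k * q : ℕ) := by
    intro q
    have := count_le_mod a k q
    rw [show Nat.count (· ∈ Z) (k * q) = q * (k - a) by simpa only [hZ, Set.mem_ofPred_eq] using this]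
    push_cast [ha]
    field_simp
  have hρ : 0 ≤ 1 - (a : ℝ) / k := sub_nonneg.2 ((div_le_one hkR).2 haR)
  set ρ := 1 - (a : ℝ) / k
  have hupper := dimH_subsetSums_le (Z := Z) h0 h1 hρ
    (φ := fun q => k * q) (C := 0)
    (Filter.tendsto_atTop_mono (fun q => Nat.le_mul_of_pos_left q hk) Filter.tendsto_id)
    fun q => by rw [hcount q, add_zero]
  have hL := logTwo_div_neg_log_pos h0 h1
  rcases hρ.eq_or_lt with hzero | hpos
  · rw [← hzero, zero_mul, ENNReal.ofReal_zero] at hupper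
    rw [← hzero, zero_mul, nonpos_iff_eq_zero.1 hupper, ENNReal.toReal_zero]
  · have hlower := le_dimH_subsetSums (Z := Z) h0 h2 hpos (C := ρ * k) fun n => by
      have hmono : Nat.count (· ∈ Z) (k * (n / k)) ≤
          Nat.count (· ∈ Z) n := Nat.count_monotone _ (Nat.mul_div_le n k)
      have hn : (n : ℝ) ≤ (k * (n / k) : ℕ) + k := by
        exact_mod_cast (Nat.lt_mul_div_succ n hk).le
      have := hcount (n / k)
      have hmonoR : (Nat.count (· ∈ Z) (k * (n / k)) : ℝ) ≤
          Nat.count (· ∈ Z) n := by exact_mod_cast hmono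
      have := mul_le_mul_of_nonneg_left hn hρ
      linarith
    rw [le_antisymm hupper hlower, ENNReal.toReal_ofReal (by positivity)]

/-- The alternating pattern on the first `2 * m` positions of each block of length `2 * k`. -/
theorem mem_selfSimilarDims (h0 : 0 < α) (h2 : α < 1 / 2) (hα : α ≤ 1 - α / (1 - α)) {m k : ℕ}
    (hk : 0 < k) (hm : m ≤ k) :
    (1 - (m : ℝ) / k) * (Real.log 2 / -Real.log α) ∈ selfSimilarDims α := by
  -- In each block `E` rises and falls `m` times, so it changes exactly after the first 2m
  -- positions. The even number of changes brings it back to 0 at the block's end.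
  let E : ℕ → ℤ := fun i => if i % (2 * k) < 2 * m ∧ i % (2 * k) % 2 = 1 then 1 else 0
  have hE : ∀ i, E i ∈ ({0, 1} : Set ℤ) := fun i => by
    simp only [E]
    split_ifs <;> simp
  have hper : ∀ i, E (2 * k + i) = E i := fun i => by simp [E]
  have h := toReal_dimH_mem_selfSimilarDims h0 (by linarith) hα hE (by omega) hper
  have hZ : {i | E (i + 1) = E i} = {i | 2 * m ≤ i % (2 * k)} := by
    ext i
    have hr : i % (2 * k) < 2 * k := Nat.mod_lt _ (by omega)
    have hs : i % (2 * k) + 1 < 2 * k ∧ (i + 1) % (2 * k) = i % (2 * k) + 1 ∨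
        i % (2 * k) + 1 = 2 * k ∧ (i + 1) % (2 * k) = 0 := by
      rcases Nat.lt_or_ge (i % (2 * k) + 1) (2 * k) with hlt | hge
      · left
        rw [Nat.add_mod, Nat.mod_eq_of_lt (by omega : 1 < 2 * k), Nat.mod_eq_of_lt hlt]
        exact ⟨hlt, rfl⟩
      · right
        have heq : i % (2 * k) + 1 = 2 * k := by omega
        rw [← Nat.mod_add_mod, heq, Nat.mod_self]
        exact ⟨rfl, rfl⟩
    simp only [Set.mem_ofPred_eq, E]
    generalize i % (2 * k) = r at hr hs
    generalize (i + 1) % (2 * k) = r' at hs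
    split_ifs <;> simp <;> omega
  rw [hZ, toReal_dimH_subsetSums_mod h0 h2 (by omega) (by omega)] at h
  convert h using 3
  push_cast
  rw [mul_div_mul_left _ _ two_ne_zero]

/-- With m = ⌊(1 - d/L)k⌋ the attained values (1 - m/k)L tend to d as k grows. -/
theorem Icc_subset_closure_selfSimilarDims (h0 : 0 < α) (h2 : α < 1 / 2)
    (hα : α ≤ 1 - α / (1 - α)) :
    Set.Icc 0 (Real.log 2 / -Real.log α) ⊆ closure (selfSimilarDims α) := by
  intro d hd
  have hL := logTwo_div_neg_log_pos h0 (by linarith)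
  set L := Real.log 2 / -Real.log α with hLdef
  have hx : d / L ≤ 1 := (div_le_one hL).2 hd.2
  have hx0 : 0 ≤ d / L := div_nonneg hd.1 hL.le
  have hfloor := (tendsto_nat_floor_mul_div_atTop (sub_nonneg.2 hx)).comp
    (tendsto_natCast_atTop_atTop (R := ℝ))
  have hlim := (hfloor.const_sub 1).mul_const L
  rw [sub_sub_cancel, div_mul_cancel₀ _ hL.ne'] at hlim
  refine mem_closure_of_tendsto hlim ?_
  filter_upwards [Filter.eventually_gt_atTop 0] with k hk
  refine mem_selfSimilarDims h0 h2 hα hk (Nat.floor_le_of_le ?_)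
  have : (0 : ℝ) ≤ k := k.cast_nonneg
  nlinarith

end Dense

/-! ### The gap above the threshold -/

section Gap

variable {α : ℝ}

/-- In a unique expansion, a digit `1` after a smaller digit is followed by a digit below `1`,
and soon by a nonzero one. -/
theorem next_digit_of_unique (h0 : 1 / 3 ≤ α) (h2 : α < 1 / 2) {N : ℕ}
    (hN : α ^ N * (α / (1 - α)) < 1 - (1 - α / (1 - α)) / α) {t : ℕ → ℤ}
    (ht : ∀ i, t i ∈ ({-1, 0, 1} : Set ℤ))
    (huniq : ∀ e : ℕ → ℤ, (∀ i, e i ∈ ({-1, 0, 1} : Set ℤ)) →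
      powSum α (fun i => (e i : ℝ)) = powSum α (fun i => (t i : ℝ)) → e = t)
    {n : ℕ} (hn : t n ≠ 1) (hn1 : t (n + 1) = 1) :
    t (n + 2) ≠ 1 ∧ ∃ j < N, t (n + 2 + j) ≠ 0 := by
  have hpos : 0 < α := by linarith
  have h1 : α < 1 := by linarith
  have hM := div_one_sub_lt_one h2
  have hT := fun i => abs_intCast_le_one (ht i)
  have htail := tail_lt_of_unique h0 h1 ht huniq hn
  -- The tail T after the digit 1 satisfies T < (1 - M)/α - 1 < -α^N M. A next digit 1 would make T
  -- positive, and `N` zeros would give T ≥ -α^N M.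
  rw [powSum_succ hpos h1 hT, hn1, mul_comm, ← lt_div_iff₀ hpos] at htail
  push_cast at htail
  have hδ : 0 < 1 - (1 - α / (1 - α)) / α :=
    lt_of_le_of_lt (mul_nonneg (by positivity) (div_nonneg hpos.le (by linarith))) hN
  constructor
  · intro h
    have hb := (abs_le.1 (abs_powSum_le hpos h1 fun i => hT (n + 2 + 1 + i))).1
    rw [powSum_succ hpos h1 hT, h] at htail
    push_cast at htail
    have : 0 < α * (1 + powSum α fun i => (t (n + 2 + 1 + i) : ℝ)) :=
      mul_pos hpos (by linarith)
    linarith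
  · by_contra! hz
    have hb := (abs_le.1 (abs_powSum_le hpos h1 fun i => hT (n + 2 + (N + i)))).1
    rw [powSum_split hpos h1 (fun i => hT (n + 1 + 1 + i)) N, Finset.sum_eq_zero fun i hi => by
      rw [hz i (Finset.mem_range.1 hi)]; simp] at htail
    have hp : 0 < α ^ N := by positivity
    have := mul_le_mul_of_nonneg_left hb hp.le
    linarith

/-- When `1 - α / (1 - α) < α`, a unique expansion is eventually zero or has nonzero digits in all
late windows of a length that depends on `α` only. -/
theorem exists_window_length (h0 : 1 / 3 ≤ α) (h2 : α < 1 / 2) (hα : 1 - α / (1 - α) < α) :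
    ∃ N : ℕ, 0 < N ∧ ∀ t : ℕ → ℤ, (∀ i, t i ∈ ({-1, 0, 1} : Set ℤ)) →
      (∀ e : ℕ → ℤ, (∀ i, e i ∈ ({-1, 0, 1} : Set ℤ)) →
        powSum α (fun i => (e i : ℝ)) = powSum α (fun i => (t i : ℝ)) → e = t) →
      (∃ k, ∀ i ≥ k, t i = 0) ∨ ∃ k, ∀ n ≥ k, ∃ j < N, t (n + j) ≠ 0 := by
  have hpos : 0 < α := by linarith
  have h1 : α < 1 := by linarith
  have hδ : 0 < 1 - (1 - α / (1 - α)) / α := sub_pos.2 ((div_lt_one hpos).2 hα)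
  have hlim : Filter.Tendsto (fun N => α ^ N * (α / (1 - α))) Filter.atTop (nhds 0) := by
    simpa using (tendsto_pow_atTop_nhds_zero_of_lt_one hpos.le h1).mul_const (α / (1 - α))
  obtain ⟨N, hN⟩ := (hlim.eventually_lt_const hδ).exists
  -- Every late [k, k + N] will contain an `n` with t (n + 1) ≠ 0, so the offset of that digit from
  -- `k` is at most N + 1.
  refine ⟨N + 2, by omega, fun t ht huniq => ?_⟩
  -- Negating all digits preserves uniqueness, so -1 obeys the mirrored rule.
  have hneg : ∀ n, t n ≠ -1 → t (n + 1) = -1 →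
      t (n + 2) ≠ -1 ∧ ∃ j < N, t (n + 2 + j) ≠ 0 := by
    intro n hn hn1
    have hmem : ∀ {a : ℤ}, a ∈ ({-1, 0, 1} : Set ℤ) → -a ∈ ({-1, 0, 1} : Set ℤ) := by
      rintro a (rfl | rfl | rfl) <;> simp
    have huniq' : ∀ e : ℕ → ℤ, (∀ i, e i ∈ ({-1, 0, 1} : Set ℤ)) →
        powSum α (fun i => (e i : ℝ)) = powSum α (fun i => ((-t i : ℤ) : ℝ)) →
        e = fun i => -t i := by
      intro e he heq
      have := huniq (fun i => -e i) (fun i => hmem (he i)) (by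
        push_cast at heq ⊢
        rw [powSum_neg, heq, powSum_neg, neg_neg])
      funext i
      rw [← this, neg_neg]
    have := next_digit_of_unique h0 h2 hN (t := fun i => -t i) (fun i => hmem (ht i)) huniq'
      (n := n) (by omega) (by omega)
    simpa [neg_eq_iff_eq_neg] using this
  have hnext : ∀ n, t (n + 1) ≠ 0 → t n ≠ t (n + 1) →
      t (n + 2) ≠ t (n + 1) ∧ ∃ j < N, t (n + 2 + j) ≠ 0 := by
    intro n hn hne
    rcases signs_cases (ht (n + 1)) with h | h | h
    · rw [h] at hne ⊢
      exact hneg n hne h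
    · exact absurd h hn
    · rw [h] at hne ⊢
      exact next_digit_of_unique h0 h2 hN ht huniq hne h
  by_cases hgood : ∃ n, t (n + 1) ≠ 0 ∧ t n ≠ t (n + 1)
  · right
    obtain ⟨n₀, hn₀⟩ := hgood
    have hstep : ∀ n, (t (n + 1) ≠ 0 ∧ t n ≠ t (n + 1)) →
        ∃ n', n < n' ∧ n' ≤ n + N ∧ t (n' + 1) ≠ 0 ∧ t n' ≠ t (n' + 1) := by
      rintro n ⟨hn, hne⟩
      -- The next nonzero digit again differs from its predecessor: either it follows at once and
      -- `hne'` applies, or a zero precedes it.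
      obtain ⟨hne', hex⟩ := hnext n hn hne
      have hspec := Nat.find_spec hex
      have hmin := fun j (hj : j < Nat.find hex) => Nat.find_min hex hj
      generalize Nat.find hex = j at hspec hmin
      refine ⟨n + 1 + j, by omega, by omega, ?_, ?_⟩
      · rw [show n + 1 + j + 1 = n + 2 + j by ring]
        exact hspec.2
      · rw [show n + 1 + j + 1 = n + 2 + j by ring]
        rcases j with _ | j
        · exact hne'.symm
        · have := hmin j (by omega)
          have hz : t (n + 2 + j) = 0 := by
            by_contra hcon
            exact this ⟨by omega, hcon⟩
          rw [show n + 1 + (j + 1) = n + 2 + j by ring, hz]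
          exact hspec.2.symm
    have hall : ∀ k, n₀ ≤ k → ∃ n, k ≤ n ∧ n ≤ k + N ∧ t (n + 1) ≠ 0 ∧ t n ≠ t (n + 1) := by
      intro k hk
      induction k, hk using Nat.le_induction with
      | base => exact ⟨n₀, le_rfl, by omega, hn₀⟩
      | succ k _ ih =>
        obtain ⟨n, h3, h4, h5⟩ := ih
        rcases h3.eq_or_lt with rfl | hlt
        · obtain ⟨n', h6, h7, h8⟩ := hstep _ h5
          exact ⟨n', h6, by omega, h8⟩
        · exact ⟨n, hlt, by omega, h5⟩
    refine ⟨n₀, fun k hk => ?_⟩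
    obtain ⟨n, h3, h4, h5, -⟩ := hall k hk
    refine ⟨n + 1 - k, by omega, ?_⟩
    rwa [show k + (n + 1 - k) = n + 1 by omega]
  -- Now each nonzero digit after the initial one equals its predecessor, so a single zero makes all
  -- later digits zero.
  · push Not at hgood
    by_cases hzero : ∃ k, t k = 0
    · left
      obtain ⟨k, hk⟩ := hzero
      refine ⟨k, fun i hi => ?_⟩
      induction i, hi using Nat.le_induction with
      | base => exact hk
      | succ i _ ih =>
        by_contra hne
        exact hne ((hgood i hne).symm.trans ih)
    · right
      push Not at hzero
      exact ⟨0, fun n _ => ⟨0, by omega, hzero _⟩⟩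

open Classical in
/-- A set of exponents that misses a point of every late window of length `N` has few subset
sums. -/
theorem toReal_dimH_subsetSums_le_of_window (h0 : 0 < α) (h1 : α < 1) {N k : ℕ} (hN : 0 < N)
    {Z : Set ℕ} (hZ : ∀ n ≥ k, ∃ j < N, n + j ∉ Z) :
    (dimH (subsetSums α Z)).toReal ≤ (1 - 1 / (N : ℝ)) * (Real.log 2 / -Real.log α) := by
  have hNR : (1 : ℝ) ≤ N := by exact_mod_cast hN
  have hcount : ∀ m, Nat.count (· ∈ Z) (k + m * N) + m ≤ k + m * N := by
    intro m
    induction m with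
    | zero => simpa using Nat.count_le _
    | succ m ih =>
      rw [show k + (m + 1) * N = k + m * N + N by ring, Nat.count_add]
      have hle : Nat.count (fun i => k + m * N + i ∈ Z) N ≤ N := Nat.count_le _
      have hne : Nat.count (fun i => k + m * N + i ∈ Z) N ≠ N := by
        intro h
        obtain ⟨j, hj, hjZ⟩ := hZ (k + m * N) (by omega)
        exact hjZ (Nat.count_iff_forall.1 h j hj)
      omega
  have hρ : 0 ≤ 1 - 1 / (N : ℝ) := sub_nonneg.2 ((div_le_one (by linarith)).2 hNR)
  have h := dimH_subsetSums_le (Z := Z) h0 h1 hρ (φ := fun m => k + m * N) (C := k)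
    (Filter.tendsto_atTop_mono (fun m => (Nat.le_mul_of_pos_right m hN).trans
      (Nat.le_add_left _ _)) Filter.tendsto_id) fun m => by
    have hc : (Nat.count (· ∈ Z) (k + m * N) : ℝ) + m ≤ k + m * N := by exact_mod_cast hcount m
    have hk : (0 : ℝ) ≤ k := k.cast_nonneg
    have hexp : (1 - 1 / (N : ℝ)) * (k + m * N) = (1 - 1 / (N : ℝ)) * k + m * N - m := by
      field_simp
      ring
    push_cast
    rw [hexp]
    have := mul_nonneg hρ hk
    linarith
  exact ENNReal.toReal_le_of_le_ofReal
    (mul_nonneg hρ (logTwo_div_neg_log_pos h0 h1).le) h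

open Classical in
-- This is the case of an eventually zero expansion: finitely many forced digits do not lower the
-- density of the free ones.
theorem toReal_dimH_subsetSums_of_cofinite (h0 : 0 < α) (h2 : α < 1 / 2) {Z : Set ℕ} {k : ℕ}
    (hZ : ∀ i ≥ k, i ∈ Z) :
    (dimH (subsetSums α Z)).toReal = Real.log 2 / -Real.log α := by
  have h1 : α < 1 := by linarith
  have hcount : ∀ n, n ≤ Nat.count (· ∈ Z) n + k := by
    intro n
    induction n with
    | zero => omega
    | succ n ih =>
      rw [Nat.count_succ]
      by_cases hn : n ∈ Z
      · simp only [hn, if_true]; omega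
      · have : n < k := by
          by_contra! hcon
          exact hn (hZ n hcon)
        omega
  have h := le_dimH_subsetSums (Z := Z) h0 h2 one_pos (C := k) fun n => by
    have : (n : ℝ) ≤ Nat.count (· ∈ Z) n + k := by exact_mod_cast hcount n
    linarith
  rw [one_mul] at h
  exact le_antisymm (toReal_dimH_subsetSums_le h0 h1 Z)
    ((ENNReal.ofReal_le_iff_le_toReal (Real.dimH_ne_top _)).1 h)

/-- The dimensions lie in the closed set (-∞, (1 - 1/N)L] ∪ {L}, which misses L - L/(2N). -/
theorem not_Icc_subset_closure_selfSimilarDims (h0 : 1 / 3 ≤ α) (h2 : α < 1 / 2)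
    (hα : 1 - α / (1 - α) < α) :
    ¬ Set.Icc 0 (Real.log 2 / -Real.log α) ⊆ closure (selfSimilarDims α) := by
  have hpos : 0 < α := by linarith
  have h1 : α < 1 := by linarith
  have hL := logTwo_div_neg_log_pos hpos h1
  obtain ⟨N, hN, hwin⟩ := exists_window_length h0 h2 hα
  have hNR : (1 : ℝ) ≤ N := by exact_mod_cast hN
  set L := Real.log 2 / -Real.log α with hLdef
  have hsub : selfSimilarDims α ⊆ Set.Iic ((1 - 1 / (N : ℝ)) * L) ∪ {L} := by
    rintro d ⟨t, ⟨⟨-, e, he, huniq⟩, -⟩, rfl⟩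
    rw [cantorInter_eq hpos h1 he huniq, dimH_add_image]
    rcases hwin e he.1 fun f hf heq => huniq f (by
        rw [he.eq_powSum, ← heq]
        exact isExpansion_powSum hpos h1 subset_rfl hf) with ⟨k, hk⟩ | ⟨k, hk⟩
    · exact Or.inr (toReal_dimH_subsetSums_of_cofinite hpos h2 hk)
    · exact Or.inl (toReal_dimH_subsetSums_le_of_window hpos h1 hN hk)
  have hclosed : closure (selfSimilarDims α) ⊆ Set.Iic ((1 - 1 / (N : ℝ)) * L) ∪ {L} :=
    closure_minimal hsub (isClosed_Iic.union isClosed_singleton)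
  intro hcon
  have hinv : 1 / (N : ℝ) ≤ 1 := (div_le_one (by linarith)).2 hNR
  have hinv0 : 0 < 1 / (N : ℝ) := by positivity
  have hgap : 0 < 1 / (N : ℝ) * L := mul_pos hinv0 hL
  have hgap' : 1 / (N : ℝ) * L ≤ L := mul_le_of_le_one_left hL.le hinv
  rcases hclosed (hcon (⟨by linarith, by linarith⟩ :
    L - 1 / (N : ℝ) * L / 2 ∈ Set.Icc 0 L)) with h | h
  · rw [Set.mem_Iic] at h
    linarith
  · rw [Set.mem_singleton_iff] at h
    linarith

end Gap

/-- Clearing denominators gives α² - 3α + 1 ≥ 0, whose smaller root is (3 - √5)/2; the larger root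
exceeds 1/2. -/
theorem le_one_sub_div_iff {α : ℝ} (h2 : α < 1 / 2) :
    α ≤ 1 - α / (1 - α) ↔ α ≤ (3 - Real.sqrt 5) / 2 := by
  have hs : 0 < 1 - α := by linarith
  have h5 : Real.sqrt 5 ^ 2 = 5 := Real.sq_sqrt (by norm_num)
  have h50 : 0 ≤ Real.sqrt 5 := Real.sqrt_nonneg 5
  rw [le_sub_comm, div_le_iff₀ hs]
  constructor
  · intro h
    by_contra! hcon
    nlinarith
  · intro h
    nlinarith

/-- Density in `[0, log 2 / (-log α)]`: the set of dimensions is contained in this interval, and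
density means that its closure contains the interval. -/
theorem theorem1p3 (α : ℝ) :
    (1 / 3 < α → α ≤ (3 - Real.sqrt 5) / 2 →
      selfSimilarDims α ⊆ Set.Icc 0 (Real.log 2 / (-Real.log α)) ∧
        Set.Icc 0 (Real.log 2 / (-Real.log α)) ⊆ closure (selfSimilarDims α)) ∧
    ((3 - Real.sqrt 5) / 2 < α → α < 1 / 2 →
      selfSimilarDims α ⊆ Set.Icc 0 (Real.log 2 / (-Real.log α)) ∧
        ¬ Set.Icc 0 (Real.log 2 / (-Real.log α)) ⊆ closure (selfSimilarDims α)) := by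
  constructor
  · intro h3 h
    have h2 : α < 1 / 2 := by
      have : (2 : ℝ) < Real.sqrt 5 := Real.lt_sqrt_of_sq_lt (by norm_num)
      linarith
    exact ⟨selfSimilarDims_subset (by linarith) (by linarith),
      Icc_subset_closure_selfSimilarDims (by linarith) h2 ((le_one_sub_div_iff h2).2 h)⟩
  · intro h h2
    have h3 : 1 / 3 ≤ α := by
      have : Real.sqrt 5 ≤ 7 / 3 := Real.sqrt_le_iff.2 ⟨by norm_num, by norm_num⟩
      linarith
    refine ⟨selfSimilarDims_subset (by linarith) (by linarith),
      not_Icc_subset_closure_selfSimilarDims h3 h2 ?_⟩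
    by_contra! hcon
    exact absurd ((le_one_sub_div_iff h2).1 hcon) (not_le.2 h)
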